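/- **Theorem (Definability).** A *modal symbol* is one of $\Box_+,\Box_-,\Diamond_+,\Diamond_-$. For a binary relation $R$ on a poset $(W,\leq)$ put (composing relations from left to right) $$\Box_+[R]={\leq}\circ R\circ{\leq},\quad \Box_-[R]={\leq}\circ R\circ{\geq},\quad \Diamond_+[R]={\geq}\circ R\circ{\geq},\quad \Diamond_-[R]={\geq}\circ R\circ{\leq},$$ and call $R$ a *$\Delta_\alpha$-relation* if $\Delta_\alpha[R]=R$. Let $\mathcal L$ be a set of modal symbols. An *$\mathcal L$-modal frame* is a poset $(W,\leq)$ with a $\Delta_\alpha$-relation $R^\Delta_\alpha$ for each $\Delta_\alpha\in\mathcal L$; it is *$\mathcal L$-unimodal* if there is a single binary relation $R$ on $W$ with $R^\Delta_\alpha=\Delta_\alpha[R]$ for all $\Delta_\alpha\in\mathcal L$. The *complex algebra* of an $\mathcal L$-modal frame is the bounded distributive lattice of all upsets of $(W,\leq)$ ordered by inclusion (equivalently, with its unique implication $\rightarrow$ and co-implication $-$, where $a\wedge b\leq c\iff b\leq a\rightarrow c$ and $a\leq b\vee c\iff a-b\leq c$, the bi-Heyting algebra of all upsets), equipped for each $\Delta_\alpha\in\mathcal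 L$ with the corresponding operator among $$\Box_+a=\{u: \forall v\,(uR^\Box_+v\Rightarrow v\in a)\},\qquad \Diamond_+a=\{u:\exists v\,(uR^\Diamond_+v \text{ and } v\in a)\},$$ $$\Box_-a=\{u: \forall v\,(uR^\Box_-v\Rightarrow v\notin a)\},\qquad \Diamond_-a=\{u:\exists v\,(uR^\Diamond_-v \text{ and } v\notin a)\}.$$ A class $\mathsf K$ of $\mathcal L$-modal frames is *definable* by sentences of a given kind if there is a set $T$ of sentences of that kind such that an $\mathcal L$-modal frame belongs to $\mathsf K$ if and only if its complex algebra satisfies all sentences in $T$. Let $\mathcal L_{\mathsf{DLat}}=\{\wedge,\vee,\top,\bot\}$ and $\mathcal L_{\mathsf{BiHA}}=\{\wedge,\vee,\top,\bot,\rightarrow,-\}$, and let $\mathsf{Fr}_{\mathcal L}$ be the class of all $\mathcal L$-unimodal frames. Then the following are equivalent: (i) $\mathsf{Fr}_{\mathcal L}$ is definable by quasiequations in $\mathcal L_{\mathsf{DLat}}\cup\mathcal L$; (ii) $\mathsf{Fr}_{\mathcal L}$ is definable by universal sentences in $\mathcal L_{\mathsf{DLat}}\cup\mathcal L$; (iii)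 $\mathsf{Fr}_{\mathcal L}$ is definable by equations in $\mathcal L_{\mathsf{BiHA}}\cup\mathcal L$; (iv) $\mathsf{Fr}_{\mathcal L}$ is definable by universal sentences in $\mathcal L_{\mathsf{BiHA}}\cup\mathcal L$; (v) $\mathcal L$ contains at most two modal symbols, $\mathcal L\neq\{\Box_+,\Diamond_+\}$ and $\mathcal L\neq\{\Box_-,\Diamond_-\}$. -/

import Mathlib

open FirstOrder

universe u

namespace Unimodal

/-! ### Modal symbols and monotone relations -/

/-- The two shapes of a modal symbol. -/
inductive Shape : Type
  | box
  | dia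

/-- A polarity is `+` or `-`. -/
inductive Polarity : Type
  | pos
  | neg

/-- The opposite polarity. -/
def Polarity.opp : Polarity → Polarity
  | .pos => .neg
  | .neg => .pos

/-- A modal symbol is a shape together with a polarity. -/
structure ModalSymbol : Type where
  shape : Shape
  pol : Polarity

/-- `□₊` -/
def boxPos : ModalSymbol := ⟨.box, .pos⟩

/-- `□₋` -/
def boxNeg : ModalSymbol := ⟨.box, .neg⟩

/-- `◇₊` -/
def diaPos : ModalSymbol := ⟨.dia, .pos⟩

/-- `◇₋` -/
def diaNeg : ModalSymbol := ⟨.dia, .neg⟩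

/-- The order of the poset `W^α`: the given order if `α = +`, its dual if `α = -`. -/
def polLE {W : Type u} [PartialOrder W] : Polarity → W → W → Prop
  | .pos, x, y => x ≤ y
  | .neg, x, y => y ≤ x

/-- The order of `W ×_{Δ_α} W`, which is `W⁻ × W^α` for `Δ = □` and `W × W^{-α}` for `Δ = ◇`:
`(u, v)` lies below `(u', v')`. -/
def prodLE {W : Type u} [PartialOrder W] (m : ModalSymbol) (u v u' v' : W) : Prop :=
  match m.shape with
  | .box => polLE .neg u u' ∧ polLE m.pol v v'
  | .dia => u ≤ u' ∧ polLE m.pol.opp v v'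

/-- `R` is a `Δ_α`-relation: an upset of `W ×_{Δ_α} W`. -/
def IsMonotoneRel {W : Type u} [PartialOrder W] (m : ModalSymbol) (R : W → W → Prop) : Prop :=
  ∀ u v u' v' : W, prodLE m u v u' v' → R u v → R u' v'

/-- `Δ_α[R]`, written as a composition of relations (read from left to right). -/
def gen {W : Type u} [PartialOrder W] : ModalSymbol → (W → W → Prop) → W → W → Prop
  | ⟨.box, .pos⟩, R => Relation.Comp (· ≤ ·) (Relation.Comp R (· ≤ ·))
  | ⟨.box, .neg⟩, R => Relation.Comp (· ≤ ·) (Relation.Comp R (· ≥ ·))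
  | ⟨.dia, .pos⟩, R => Relation.Comp (· ≥ ·) (Relation.Comp R (· ≥ ·))
  | ⟨.dia, .neg⟩, R => Relation.Comp (· ≥ ·) (Relation.Comp R (· ≤ ·))

theorem gen_iff {W : Type u} [PartialOrder W] (m : ModalSymbol) (R : W → W → Prop) (u v : W) :
    gen m R u v ↔ ∃ u' v', R u' v' ∧ prodLE m u' v' u v := by
  rcases m with ⟨_ | _, _ | _⟩ <;>
    simp only [gen, prodLE, polLE, Polarity.opp, Relation.Comp] <;>
    exact ⟨fun ⟨u', h, v', hR, h'⟩ => ⟨u', v', hR, h, h'⟩,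
      fun ⟨u', v', hR, h, h'⟩ => ⟨u', h, v', hR, h'⟩⟩

/-- `Δ_α[R]` is the least `Δ_α`-relation that extends `R`. -/
theorem gen_isLeast {W : Type u} [PartialOrder W] (m : ModalSymbol) (R : W → W → Prop) :
    IsLeast {S : W → W → Prop | IsMonotoneRel m S ∧ R ≤ S} (gen m R) := by
  refine ⟨⟨fun u v u' v' h hR => ?_, fun u v hR => ?_⟩, fun S hS u v hR => ?_⟩
  · rw [gen_iff] at hR ⊢
    obtain ⟨a, b, hab, h1⟩ := hR
    refine ⟨a, b, hab, ?_⟩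
    rcases m with ⟨_ | _, _ | _⟩ <;>
      simp only [prodLE, polLE, Polarity.opp] at h h1 ⊢ <;>
      exact ⟨by order, by order⟩
  · rw [gen_iff]
    refine ⟨u, v, hR, ?_⟩
    rcases m with ⟨_ | _, _ | _⟩ <;> simp [prodLE, polLE, Polarity.opp]
  · rw [gen_iff] at hR
    obtain ⟨a, b, hab, h1⟩ := hR
    exact hS.1 a b u v h1 (hS.2 a b hab)

/-! ### Modal frames -/

/-- An `L`-modal frame: a poset with a `Δ_α`-relation for each `Δ_α ∈ L`. -/
structure ModalFrame (L : Set ModalSymbol) : Type (u + 1) where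
  World : Type u
  [order : PartialOrder World]
  rel : L → World → World → Prop
  mono : ∀ m : L, IsMonotoneRel m.1 (rel m)

attribute [instance] ModalFrame.order

/-- The class of `L`-unimodal frames: all the relations are generated by a single relation. -/
def unimodalFrames (L : Set ModalSymbol) : Set (ModalFrame.{u} L) :=
  {F | ∃ R : F.World → F.World → Prop, ∀ m : L, F.rel m = gen m.1 R}

/-! ### The bi-Heyting algebra of upsets -/

/-- The upsets of a poset, ordered by inclusion. -/
abbrev Upset (W : Type u) [PartialOrder W] : Type u := {s : Set W // IsUpperSet s}

/-- The bi-Heyting algebra of upsets; `a ⇨ b` is the Heyting implication, `a \ b` is the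
co-implication. -/
instance Upset.instBiheytingAlgebra (W : Type u) [PartialOrder W] :
    BiheytingAlgebra (Upset W) where
  sup a b := ⟨a.1 ∪ b.1, a.2.union b.2⟩
  le_sup_left _ _ := Set.subset_union_left
  le_sup_right _ _ := Set.subset_union_right
  sup_le _ _ _ h h' := Set.union_subset h h'
  inf a b := ⟨a.1 ∩ b.1, a.2.inter b.2⟩
  inf_le_left _ _ := Set.inter_subset_left
  inf_le_right _ _ := Set.inter_subset_right
  le_inf _ _ _ h h' := Set.subset_inter h h'
  top := ⟨Set.univ, isUpperSet_univ⟩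
  le_top _ := Set.subset_univ _
  bot := ⟨∅, isUpperSet_empty⟩
  bot_le _ := Set.empty_subset _
  himp a b := ⟨{u | ∀ v, u ≤ v → v ∈ a.1 → v ∈ b.1},
    fun _ _ h hx v hv => hx v (h.trans hv)⟩
  le_himp_iff a b c :=
    ⟨fun h _ hx => h hx.1 _ le_rfl hx.2, fun h _ hx v hv hb => h ⟨a.2 hv hx, hb⟩⟩
  compl a := ⟨{u | ∀ v, u ≤ v → v ∈ a.1 → v ∈ (∅ : Set W)},
    fun _ _ h hx v hv => hx v (h.trans hv)⟩
  himp_bot _ := rfl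
  sdiff a b := ⟨{u | ∃ v, v ≤ u ∧ v ∈ a.1 ∧ v ∉ b.1},
    fun _ _ h ⟨v, hv, hab⟩ => ⟨v, hv.trans h, hab⟩⟩
  sdiff_le_iff a b c :=
    ⟨fun h x hx => by
      by_cases hb : x ∈ b.1
      · exact Or.inl hb
      · exact Or.inr (h ⟨x, le_rfl, hx, hb⟩),
     fun h x ⟨v, hv, ha, hb⟩ => c.2 hv ((h ha).resolve_left hb)⟩
  hnot a := ⟨{u | ∃ v, v ≤ u ∧ v ∈ (Set.univ : Set W) ∧ v ∉ a.1},
    fun _ _ h ⟨v, hv, hab⟩ => ⟨v, hv.trans h, hab⟩⟩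
  top_sdiff _ := rfl

/-- The set of worlds assigned to `Δ_α a` by the accessibility relation `R`. -/
def modalSet {W : Type u} : ModalSymbol → (W → W → Prop) → Set W → Set W
  | ⟨.box, .pos⟩, R, a => {u | ∀ v, R u v → v ∈ a}
  | ⟨.box, .neg⟩, R, a => {u | ∀ v, R u v → v ∉ a}
  | ⟨.dia, .pos⟩, R, a => {u | ∃ v, R u v ∧ v ∈ a}
  | ⟨.dia, .neg⟩, R, a => {u | ∃ v, R u v ∧ v ∉ a}

theorem modalSet_isUpperSet {W : Type u} [PartialOrder W] {m : ModalSymbol} {R : W → W → Prop}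
    (hR : IsMonotoneRel m R) (a : Set W) : IsUpperSet (modalSet m R a) := by
  intro x y hxy hx
  rcases m with ⟨_ | _, _ | _⟩
  · exact fun v hv => hx v (hR y v x v ⟨hxy, le_rfl⟩ hv)
  · exact fun v hv => hx v (hR y v x v ⟨hxy, le_rfl⟩ hv)
  · obtain ⟨v, hv, ha⟩ := hx
    exact ⟨v, hR x v y v ⟨hxy, le_rfl⟩ hv, ha⟩
  · obtain ⟨v, hv, ha⟩ := hx
    exact ⟨v, hR x v y v ⟨hxy, le_rfl⟩ hv, ha⟩

/-- The universe of the complex algebra of a modal frame. -/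
abbrev ModalFrame.Complex {L : Set ModalSymbol} (F : ModalFrame.{u} L) : Type u := Upset F.World

/-- The modal operators of the complex algebra. -/
def ModalFrame.op {L : Set ModalSymbol} (F : ModalFrame.{u} L) (m : L) (a : F.Complex) :
    F.Complex :=
  ⟨modalSet m.1 (F.rel m) a.1, modalSet_isUpperSet (F.mono m) a.1⟩

/-! ### Signatures -/

/-- Operation symbols of bounded distributive lattices. -/
inductive DLatFunc : ℕ → Type
  | inf : DLatFunc 2
  | sup : DLatFunc 2
  | top : DLatFunc 0
  | bot : DLatFunc 0

/-- Operation symbols of bi-Heyting algebras. -/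
inductive BiHAFunc : ℕ → Type
  | inf : BiHAFunc 2
  | sup : BiHAFunc 2
  | top : BiHAFunc 0
  | bot : BiHAFunc 0
  | himp : BiHAFunc 2
  | sdiff : BiHAFunc 2

/-- A unary operation symbol for each modal symbol in `L`. -/
inductive ModalFunc (L : Set ModalSymbol) : ℕ → Type
  | op (m : L) : ModalFunc L 1

/-- The signature of bounded distributive lattices. -/
def langDLat : FirstOrder.Language.{0, 0} := ⟨DLatFunc, fun _ => Empty⟩

/-- The signature of bi-Heyting algebras. -/
def langBiHA : FirstOrder.Language.{0, 0} := ⟨BiHAFunc, fun _ => Empty⟩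

/-- The signature of the modal operators in `L`. -/
def langModal (L : Set ModalSymbol) : FirstOrder.Language.{0, 0} := ⟨ModalFunc L, fun _ => Empty⟩

instance structDLat {L : Set ModalSymbol} (F : ModalFrame.{u} L) : langDLat.Structure F.Complex where
  funMap {_} f x :=
    match f, x with
    | DLatFunc.inf, x => x 0 ⊓ x 1
    | DLatFunc.sup, x => x 0 ⊔ x 1
    | DLatFunc.top, _ => ⊤
    | DLatFunc.bot, _ => ⊥
  RelMap {_} r := nomatch r

instance structBiHA {L : Set ModalSymbol} (F : ModalFrame.{u} L) : langBiHA.Structure F.Complex where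
  funMap {_} f x :=
    match f, x with
    | BiHAFunc.inf, x => x 0 ⊓ x 1
    | BiHAFunc.sup, x => x 0 ⊔ x 1
    | BiHAFunc.top, _ => ⊤
    | BiHAFunc.bot, _ => ⊥
    | BiHAFunc.himp, x => x 0 ⇨ x 1
    | BiHAFunc.sdiff, x => x 0 \ x 1
  RelMap {_} r := nomatch r

instance structModal {L : Set ModalSymbol} (F : ModalFrame.{u} L) :
    (langModal L).Structure F.Complex where
  funMap {_} f x :=
    match f, x with
    | ModalFunc.op m, x => F.op m (x 0)
  RelMap {_} r := nomatch r

/-! ### Equations, quasiequations and definability -/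

/-- `φ` is an equation: `∀ x₁ … xₙ, s = t`. -/
def IsEquation {S : FirstOrder.Language.{0, 0}} (φ : S.Sentence) : Prop :=
  ∃ (n : ℕ) (s t : S.Term (Empty ⊕ Fin n)), φ = (s.bdEqual t).alls

/-- The conjunction of a finite list of equations between terms. -/
def premises {S : FirstOrder.Language.{0, 0}} {n : ℕ} :
    List (S.Term (Empty ⊕ Fin n) × S.Term (Empty ⊕ Fin n)) → S.BoundedFormula Empty n
  | [] => ⊤
  | p :: l => p.1.bdEqual p.2 ⊓ premises l

/-- `φ` is a quasiequation: `∀ x₁ … xₙ, s₁ = t₁ ∧ … ∧ sₖ = tₖ → s = t` with `k ≥ 0`. -/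
def IsQuasiequation {S : FirstOrder.Language.{0, 0}} (φ : S.Sentence) : Prop :=
  ∃ (n : ℕ) (prem : List (S.Term (Empty ⊕ Fin n) × S.Term (Empty ⊕ Fin n)))
    (s t : S.Term (Empty ⊕ Fin n)),
    φ = ((premises prem).imp (s.bdEqual t)).alls

/-- `φ` is a universal sentence: a string of universal quantifiers before a quantifier-free
formula. -/
def IsUniversalSentence {S : FirstOrder.Language.{0, 0}} (φ : S.Sentence) : Prop :=
  FirstOrder.Language.BoundedFormula.IsUniversal φ

/-- The class `K` of `L`-modal frames is definable by sentences of the kind `P` in the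
signature `S`: some set `T` of such sentences holds in the complex algebra of a frame `F` if
and only if `F` belongs to `K`. -/
def IsDefinableBy {L : Set ModalSymbol} (S : FirstOrder.Language.{0, 0})
    [∀ F : ModalFrame.{u} L, S.Structure F.Complex]
    (P : S.Sentence → Prop) (K : Set (ModalFrame.{u} L)) : Prop :=
  ∃ T : S.Theory, (∀ φ ∈ T, P φ) ∧ ∀ F : ModalFrame.{u} L, F ∈ K ↔ F.Complex ⊨ T

end Unimodal

/-!
If some relation generates all the relations `R_m` of a frame, then so does their intersection, so
a frame is unimodal if and only if `R_m ≤ gen m (⋂ R)` for each of its symbols `m`. For at most one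
symbol this is automatic. For two boxes, two diamonds, or a box and a diamond of opposite
polarities, the inclusion says that certain inequalities hold in the complex algebra: upsets
generated or cut out by the successors of a world, or by a single world, detect any failure.
A box and a diamond of opposite polarities require `◇a ⇨ □a = □a` and `◇a \ □a = ◇a`; by
residuation, these are quasiequations without `⇨` and `\`.

If a box and a diamond have the same polarity, take a dense chain, say with polarity `+`, and
interpret them by `<` and `>`. These relations are disjoint, so the frame is not unimodal. Replace
each point `x` of the chain by `x⁻ < x < x⁺` and extend an upset to `x⁻` and `x⁺` by its one-sided
limits. This embeds the complex algebra into that of the unimodal frame generated by the identity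
relation on the new points `x⁻` and `x⁺`, and universal sentences pass to subalgebras. For
polarity `-`, compose all relations with the reflection of the chain. Symbols of the other polarity
are interpreted by the total relation.
-/

namespace Unimodal

open FirstOrder.Language BoundedFormula

/-! ### Universal sentences, quasiequations and equations -/

section Universal

variable {S : FirstOrder.Language} {α : Type*} {n : ℕ} {φ : S.BoundedFormula α n}

theorem isUniversal_alls (h : φ.IsUniversal) : IsUniversal φ.alls := by
  induction n with
  | zero => exact h
  | succ n ih => exact ih h.all

variable {S' : FirstOrder.Language} (g : S →ᴸ S')

theorem isQF_onBoundedFormula (h : φ.IsQF) : (g.onBoundedFormula φ).IsQF := by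
  induction h with
  | falsum => exact IsQF.falsum
  | of_isAtomic h =>
    cases h with
    | equal => exact (IsAtomic.equal _ _).isQF
    | rel => exact (IsAtomic.rel _ _).isQF
  | imp _ _ ih₁ ih₂ => exact ih₁.imp ih₂

theorem isUniversal_onBoundedFormula (h : φ.IsUniversal) :
    (g.onBoundedFormula φ).IsUniversal := by
  induction h with
  | of_isQF h => exact (isQF_onBoundedFormula g h).isUniversal
  | all _ ih => exact ih.all

theorem onFormula_alls (φ : S.BoundedFormula α n) :
    g.onFormula φ.alls = (g.onBoundedFormula φ).alls := by
  induction n with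
  | zero => rfl
  | succ n ih => exact ih φ.all

end Universal

section Equations

variable {S : FirstOrder.Language.{0, 0}} {n : ℕ}

/-- The identity `s = t`, as a sentence. -/
def eqn (s t : S.Term (Empty ⊕ Fin n)) : S.Sentence := (s.bdEqual t).alls

/-- The quasi-identity deriving `s = t` from the list `prem` of identities, as a sentence. -/
def quasieqn (prem : List (S.Term (Empty ⊕ Fin n) × S.Term (Empty ⊕ Fin n)))
    (s t : S.Term (Empty ⊕ Fin n)) : S.Sentence :=
  ((premises prem).imp (s.bdEqual t)).alls

theorem isEquation_eqn (s t : S.Term (Empty ⊕ Fin n)) : IsEquation (eqn s t) :=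
  ⟨n, s, t, rfl⟩

theorem isQuasiequation_quasieqn (prem : List (S.Term (Empty ⊕ Fin n) × S.Term (Empty ⊕ Fin n)))
    (s t : S.Term (Empty ⊕ Fin n)) : IsQuasiequation (quasieqn prem s t) :=
  ⟨n, prem, s, t, rfl⟩

theorem isQF_premises (prem : List (S.Term (Empty ⊕ Fin n) × S.Term (Empty ⊕ Fin n))) :
    (premises prem).IsQF := by
  induction prem with
  | nil => exact IsQF.top
  | cons p l ih => exact (IsAtomic.equal p.1 p.2).isQF.inf ih

theorem IsQuasiequation.isUniversalSentence {φ : S.Sentence} (h : IsQuasiequation φ) :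
    IsUniversalSentence φ := by
  obtain ⟨n, prem, s, t, rfl⟩ := h
  exact isUniversal_alls ((isQF_premises prem).imp (IsAtomic.equal s t).isQF).isUniversal

theorem IsEquation.isUniversalSentence {φ : S.Sentence} (h : IsEquation φ) :
    IsUniversalSentence φ := by
  obtain ⟨n, s, t, rfl⟩ := h
  exact isUniversal_alls (IsAtomic.equal s t).isUniversal

theorem IsUniversalSentence.onSentence {S' : FirstOrder.Language.{0, 0}} (g : S →ᴸ S')
    {φ : S.Sentence} (h : IsUniversalSentence φ) : IsUniversalSentence (g.onSentence φ) :=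
  isUniversal_onBoundedFormula g h

theorem IsEquation.onSentence {S' : FirstOrder.Language.{0, 0}} (g : S →ᴸ S') {φ : S.Sentence}
    (h : IsEquation φ) : IsEquation (g.onSentence φ) := by
  obtain ⟨n, s, t, rfl⟩ := h
  exact ⟨n, g.onTerm s, g.onTerm t, onFormula_alls g _⟩

variable {M : Type*} [S.Structure M]

theorem realize_eqn (s t : S.Term (Empty ⊕ Fin n)) :
    M ⊨ eqn s t ↔ ∀ x : Fin n → M,
      s.realize (Sum.elim default x) = t.realize (Sum.elim default x) :=
  realize_alls.trans (forall_congr' fun _ => realize_bdEqual s t)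

theorem realize_premises (prem : List (S.Term (Empty ⊕ Fin n) × S.Term (Empty ⊕ Fin n)))
    (v : Empty → M) (x : Fin n → M) :
    (premises prem).Realize v x ↔
      ∀ p ∈ prem, p.1.realize (Sum.elim v x) = p.2.realize (Sum.elim v x) := by
  induction prem with
  | nil => simp [premises]
  | cons p l ih => simp [premises, ih]

theorem realize_quasieqn (prem : List (S.Term (Empty ⊕ Fin n) × S.Term (Empty ⊕ Fin n)))
    (s t : S.Term (Empty ⊕ Fin n)) :
    M ⊨ quasieqn prem s t ↔ ∀ x : Fin n → M,
      (∀ p ∈ prem, p.1.realize (Sum.elim default x) = p.2.realize (Sum.elim default x)) →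
        s.realize (Sum.elim default x) = t.realize (Sum.elim default x) := by
  refine realize_alls.trans (forall_congr' fun x => ?_)
  rw [realize_imp, realize_premises, realize_bdEqual]

end Equations

/-! ### Definability -/

section Definability

variable {L : Set ModalSymbol} {S S' : FirstOrder.Language.{0, 0}}
  [∀ F : ModalFrame.{u} L, S.Structure F.Complex]
  [∀ F : ModalFrame.{u} L, S'.Structure F.Complex]
  {K : Set (ModalFrame.{u} L)} {P : S.Sentence → Prop}

theorem isDefinableBy_of_forall_mem (h : ∀ F, F ∈ K) : IsDefinableBy S P K :=
  ⟨∅, by simp, fun F => by simp [h F]⟩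

theorem isDefinableBy_pair {φ ψ : S.Sentence} (hφ : P φ) (hψ : P ψ)
    (h : ∀ F : ModalFrame.{u} L, F ∈ K ↔ F.Complex ⊨ φ ∧ F.Complex ⊨ ψ) :
    IsDefinableBy S P K :=
  ⟨{φ, ψ}, by rintro _ (rfl | rfl) <;> assumption, fun F => by
    simp [h F, Theory.model_iff]⟩

theorem IsDefinableBy.of_forall_exists {Q : S'.Sentence → Prop}
    (hPQ : ∀ φ, P φ → ∃ ψ, Q ψ ∧ ∀ F : ModalFrame.{u} L, F.Complex ⊨ ψ ↔ F.Complex ⊨ φ)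
    (h : IsDefinableBy S P K) : IsDefinableBy S' Q K := by
  obtain ⟨T, hT, hK⟩ := h
  choose! tr hQ htr using hPQ
  refine ⟨tr '' T, Set.forall_mem_image.2 fun φ hφ => hQ φ (hT φ hφ), fun F => ?_⟩
  rw [hK F, Theory.model_iff, Theory.model_iff, Set.forall_mem_image]
  exact forall₂_congr fun φ hφ => (htr φ (hT φ hφ) F).symm

theorem IsDefinableBy.mono {Q : S.Sentence → Prop} (hPQ : ∀ φ, P φ → Q φ)
    (h : IsDefinableBy S P K) : IsDefinableBy S Q K :=
  h.of_forall_exists fun φ hφ => ⟨φ, hPQ φ hφ, fun _ => Iff.rfl⟩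

theorem IsDefinableBy.onSentence (g : S →ᴸ S')
    [∀ F : ModalFrame.{u} L, g.IsExpansionOn F.Complex] {Q : S'.Sentence → Prop}
    (hPQ : ∀ φ, P φ → Q (g.onSentence φ)) (h : IsDefinableBy S P K) : IsDefinableBy S' Q K :=
  h.of_forall_exists fun φ hφ =>
    ⟨g.onSentence φ, hPQ φ hφ, fun F => g.realize_onSentence F.Complex φ⟩

theorem IsDefinableBy.quasiequation_of_equation (h : IsDefinableBy S IsEquation K) :
    IsDefinableBy S IsQuasiequation K := by
  refine h.of_forall_exists ?_
  rintro _ ⟨n, s, t, rfl⟩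
  refine ⟨quasieqn [] s t, isQuasiequation_quasieqn _ _ _, fun F => ?_⟩
  rw [realize_quasieqn, ← eqn, realize_eqn]
  simp only [List.not_mem_nil, false_imp_iff, implies_true, true_imp_iff]

theorem not_isDefinableBy_of_embedding {F G : ModalFrame.{u} L} (hF : F ∉ K) (hG : G ∈ K)
    (e : F.Complex ↪[S] G.Complex) : ¬ IsDefinableBy S IsUniversalSentence K := by
  rintro ⟨T, hT, hK⟩
  have : T.IsUniversal := ⟨fun φ hφ => hT φ hφ⟩
  have := (hK G).1 hG
  exact hF ((hK F).2 (Theory.IsUniversal.models_of_embedding e))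

end Definability

/-! ### Modal lattice terms and modal bi-Heyting terms -/

/-- The inclusion of the signature of bounded lattices in that of bi-Heyting algebras. -/
def dlatToBiHA : langDLat →ᴸ langBiHA where
  onFunction {_} f :=
    match f with
    | DLatFunc.inf => BiHAFunc.inf
    | DLatFunc.sup => BiHAFunc.sup
    | DLatFunc.top => BiHAFunc.top
    | DLatFunc.bot => BiHAFunc.bot
  onRelation {_} r := nomatch r

instance {L : Set ModalSymbol} (F : ModalFrame.{u} L) : dlatToBiHA.IsExpansionOn F.Complex where
  map_onFunction {_} f x := by cases f <;> rfl
  map_onRelation {_} r := nomatch r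

/-- The inclusion of the modal lattice signature in the modal bi-Heyting signature. -/
abbrev modalDLatToBiHA (L : Set ModalSymbol) :
    langDLat.sum (langModal L) →ᴸ langBiHA.sum (langModal L) :=
  dlatToBiHA.sumMap (LHom.id _)

section Terms

variable {L : Set ModalSymbol} {S : FirstOrder.Language.{0, 0}} {α : Type*}

/-- The term `m t`, in any signature that contains the operators in `L`. -/
def opTerm (m : L) (t : (S.sum (langModal L)).Term α) : (S.sum (langModal L)).Term α :=
  Functions.apply₁ (Sum.inr (ModalFunc.op m)) t

/-- The term `s ⊓ t`. -/
def infTerm (s t : (langDLat.sum (langModal L)).Term α) : (langDLat.sum (langModal L)).Term α :=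
  Functions.apply₂ (Sum.inl DLatFunc.inf) s t

/-- The term `s ⊔ t`. -/
def supTerm (s t : (langDLat.sum (langModal L)).Term α) : (langDLat.sum (langModal L)).Term α :=
  Functions.apply₂ (Sum.inl DLatFunc.sup) s t

/-- The term `s ⇨ t`. -/
def himpTerm (s t : (langBiHA.sum (langModal L)).Term α) : (langBiHA.sum (langModal L)).Term α :=
  Functions.apply₂ (Sum.inl BiHAFunc.himp) s t

/-- The term `s \ t`. -/
def sdiffTerm (s t : (langBiHA.sum (langModal L)).Term α) : (langBiHA.sum (langModal L)).Term α :=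
  Functions.apply₂ (Sum.inl BiHAFunc.sdiff) s t

variable {F : ModalFrame.{u} L} (v : α → F.Complex)

theorem realize_opTerm [S.Structure F.Complex] (m : L) (t : (S.sum (langModal L)).Term α) :
    (opTerm m t).realize v = F.op m (t.realize v) := rfl

theorem realize_infTerm (s t : (langDLat.sum (langModal L)).Term α) :
    (infTerm s t).realize v = s.realize v ⊓ t.realize v := rfl

theorem realize_himpTerm (s t : (langBiHA.sum (langModal L)).Term α) :
    (himpTerm s t).realize v = s.realize v ⇨ t.realize v := rfl

theorem realize_sdiffTerm (s t : (langBiHA.sum (langModal L)).Term α) :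
    (sdiffTerm s t).realize v = s.realize v \ t.realize v := rfl

end Terms

section Inequalities

variable {L : Set ModalSymbol} {n : ℕ}

/-- The inequality `s ≤ t` between lattice terms, encoded by the equation `s ⊓ t = s`. -/
def leqn (s t : (langDLat.sum (langModal L)).Term (Empty ⊕ Fin n)) :
    (langDLat.sum (langModal L)).Sentence :=
  eqn (infTerm s t) s

/-- The implication from `s' ≤ t'` to `s ≤ t` between lattice terms, encoded as a
quasiequation. -/
def qleqn (s' t' s t : (langDLat.sum (langModal L)).Term (Empty ⊕ Fin n)) :
    (langDLat.sum (langModal L)).Sentence :=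
  quasieqn [(infTerm s' t', s')] (infTerm s t) s

theorem isEquation_leqn (s t : (langDLat.sum (langModal L)).Term (Empty ⊕ Fin n)) :
    IsEquation (leqn s t) :=
  isEquation_eqn _ _

theorem isQuasiequation_qleqn (s' t' s t : (langDLat.sum (langModal L)).Term (Empty ⊕ Fin n)) :
    IsQuasiequation (qleqn s' t' s t) :=
  isQuasiequation_quasieqn _ _ _

variable {F : ModalFrame.{u} L}

theorem realize_leqn (s t : (langDLat.sum (langModal L)).Term (Empty ⊕ Fin n)) :
    F.Complex ⊨ leqn s t ↔ ∀ x : Fin n → F.Complex,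
      s.realize (Sum.elim default x) ≤ t.realize (Sum.elim default x) := by
  simp only [leqn, realize_eqn, realize_infTerm, inf_eq_left]

theorem realize_qleqn (s' t' s t : (langDLat.sum (langModal L)).Term (Empty ⊕ Fin n)) :
    F.Complex ⊨ qleqn s' t' s t ↔ ∀ x : Fin n → F.Complex,
      s'.realize (Sum.elim default x) ≤ t'.realize (Sum.elim default x) →
        s.realize (Sum.elim default x) ≤ t.realize (Sum.elim default x) := by
  simp only [qleqn, realize_quasieqn, List.forall_mem_singleton, realize_infTerm, inf_eq_left]

end Inequalities

theorem forall_fin_two_fun {α : Type*} {p : α → α → Prop} :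
    (∀ x : Fin 2 → α, p (x 0) (x 1)) ↔ ∀ a b, p a b :=
  ⟨fun h a b => h ![a, b], fun h _ => h _ _⟩

/-! ### Generated relations and unimodal frames -/

section Polarity

variable {W : Type u}

/-- The set `a` or its complement, according to the polarity: a box of polarity `α` says that all
the successors lie in `polSet α a`, a diamond of polarity `α` that one of them does. -/
def polSet : Polarity → Set W → Set W
  | .pos, a => a
  | .neg, a => aᶜ

theorem mem_polSet_opp {α : Polarity} {a : Set W} {w : W} :
    w ∈ polSet α.opp a ↔ w ∉ polSet α a := by
  cases α
  · exact Iff.rfl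
  · exact not_not.symm

theorem mem_modalSet_box {α : Polarity} {R : W → W → Prop} {a : Set W} {u : W} :
    u ∈ modalSet ⟨.box, α⟩ R a ↔ ∀ v, R u v → v ∈ polSet α a := by
  cases α <;> rfl

theorem mem_modalSet_dia {α : Polarity} {R : W → W → Prop} {a : Set W} {u : W} :
    u ∈ modalSet ⟨.dia, α⟩ R a ↔ ∃ v, R u v ∧ v ∈ polSet α a := by
  cases α <;> rfl

variable [PartialOrder W]

theorem polLE_refl (α : Polarity) (w : W) : polLE α w w := by
  cases α <;> exact le_rfl

theorem polLE_opp {α : Polarity} {v w : W} : polLE α.opp v w ↔ polLE α w v := by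
  cases α <;> rfl

theorem polLE_mem_polSet {α : Polarity} (a : Upset W) {v w : W} (h : polLE α v w)
    (hv : v ∈ polSet α a.1) : w ∈ polSet α a.1 := by
  cases α
  · exact a.2 h hv
  · exact fun hw => hv (a.2 h hw)

theorem exists_polSet_eq (α : Polarity) (w : W) :
    ∃ a : Upset W, polSet α a.1 = {v | ¬ polLE α v w} := by
  cases α
  · exact ⟨⟨{v | ¬ v ≤ w}, (isLowerSet_Iic w).compl⟩, rfl⟩
  · exact ⟨⟨{v | w ≤ v}, isUpperSet_Ici w⟩, rfl⟩

variable {R S : W → W → Prop}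

theorem gen_le {m : ModalSymbol} (hS : IsMonotoneRel m S) (h : R ≤ S) : gen m R ≤ S :=
  (gen_isLeast m R).2 ⟨hS, h⟩

theorem le_gen (m : ModalSymbol) (R : W → W → Prop) : R ≤ gen m R :=
  (gen_isLeast m R).1.2

theorem gen_box_iff {α : Polarity} {u v : W} :
    gen ⟨.box, α⟩ R u v ↔ ∃ u' v', R u' v' ∧ u ≤ u' ∧ polLE α v' v :=
  gen_iff ⟨.box, α⟩ R u v

theorem gen_dia_iff {α : Polarity} {u v : W} :
    gen ⟨.dia, α⟩ R u v ↔ ∃ u' v', R u' v' ∧ u' ≤ u ∧ polLE α v v' := by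
  simp only [← polLE_opp (α := α)]
  exact gen_iff ⟨.dia, α⟩ R u v

end Polarity

section UnimodalFrames

variable {L : Set ModalSymbol} {F : ModalFrame.{u} L}

theorem mem_unimodalFrames_iff :
    F ∈ unimodalFrames L ↔ ∀ m : L, F.rel m ≤ gen m.1 (⨅ m', F.rel m') := by
  constructor
  · rintro ⟨R, hR⟩ m
    have hR_le : R ≤ ⨅ m', F.rel m' := le_iInf fun m' => hR m' ▸ le_gen m'.1 R
    rw [hR m]
    exact gen_le (gen_isLeast m.1 _).1.1 (hR_le.trans (le_gen _ _))
  · exact fun h => ⟨⨅ m', F.rel m', fun m => (h m).antisymm (gen_le (F.mono m) (iInf_le _ m))⟩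

theorem mem_unimodalFrames_of_subsingleton (hL : L.Subsingleton) (F : ModalFrame.{u} L) :
    F ∈ unimodalFrames L := by
  refine mem_unimodalFrames_iff.2 fun m => le_trans (le_iInf fun m' => ?_) (le_gen m.1 _)
  rw [show m' = m from Subtype.ext (hL m'.2 m.2)]

theorem mem_unimodalFrames_pair_iff {m₁ m₂ : ModalSymbol} (h₁ : m₁ ∈ L) (h₂ : m₂ ∈ L)
    (hL : L ⊆ {m₁, m₂}) :
    F ∈ unimodalFrames L ↔
      F.rel ⟨m₁, h₁⟩ ≤ gen m₁ (F.rel ⟨m₁, h₁⟩ ⊓ F.rel ⟨m₂, h₂⟩) ∧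
      F.rel ⟨m₂, h₂⟩ ≤ gen m₂ (F.rel ⟨m₁, h₁⟩ ⊓ F.rel ⟨m₂, h₂⟩) := by
  have forall_mem {p : L → Prop} : (∀ m, p m) ↔ p ⟨m₁, h₁⟩ ∧ p ⟨m₂, h₂⟩ := by
    refine ⟨fun h => ⟨h _, h _⟩, fun h => ?_⟩
    rintro ⟨m, hm⟩
    rcases hL hm with rfl | rfl
    exacts [h.1, h.2]
  have iInf_eq : ⨅ m', F.rel m' = F.rel ⟨m₁, h₁⟩ ⊓ F.rel ⟨m₂, h₂⟩ :=
    eq_of_forall_le_iff fun R => by rw [le_iInf_iff, forall_mem, le_inf_iff]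
  rw [mem_unimodalFrames_iff, iInf_eq, forall_mem]

end UnimodalFrames

/-! ### Two symbols of the same shape -/

section SameShape

section Poset

variable {W : Type u} [PartialOrder W] {P N : Set W}

theorem forall_exists_le_iff (hN : IsLowerSet N) :
    (∀ v ∈ P, ∃ v' ∈ P ∩ N, v' ≤ v) ↔
      ∀ a b : Upset W, (∀ v ∈ P, v ∈ (a ⊔ b).1) → (∀ v ∈ N, v ∉ b.1) → ∀ v ∈ P, v ∈ a.1 := by
  constructor
  · intro h a b hP hb v hv
    obtain ⟨v', ⟨hvP, hvN⟩, hle⟩ := h v hv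
    exact a.2 hle ((hP v' hvP).resolve_right (hb v' hvN))
  · intro h
    refine h ⟨upperClosure (P ∩ N), (upperClosure (P ∩ N)).upper⟩ ⟨Nᶜ, hN.compl⟩ (fun v hv => ?_)
      fun v hv hv' => hv' hv
    by_cases hvN : v ∈ N
    · exact .inl (subset_upperClosure ⟨hv, hvN⟩)
    · exact .inr hvN

theorem forall_exists_ge_iff (hP : IsUpperSet P) :
    (∀ v ∈ N, ∃ v' ∈ P ∩ N, v ≤ v') ↔
      ∀ a b : Upset W, (∀ v ∈ P, v ∈ a.1) → (∀ v ∈ N, v ∉ (a ⊓ b).1) → ∀ v ∈ N, v ∉ b.1 := by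
  constructor
  · intro h a b ha hN v hv hvb
    obtain ⟨v', ⟨hvP, hvN⟩, hle⟩ := h v hv
    exact hN v' hvN ⟨ha v' hvP, b.2 hle hvb⟩
  · intro h v hv
    let b : Upset W := ⟨(lowerClosure (P ∩ N) : Set W)ᶜ, (lowerClosure (P ∩ N)).lower.compl⟩
    exact not_not.1 (h ⟨P, hP⟩ b (fun _ => id)
      (fun w hw hw' => hw'.2 (subset_lowerClosure ⟨hw'.1, hw⟩)) v hv)

variable {R S T : W → W → Prop} {α β γ : Polarity}

theorem le_gen_box_inf_iff (hR : IsMonotoneRel ⟨.box, α⟩ R) (hS : IsMonotoneRel ⟨.box, β⟩ S) :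
    T ≤ gen ⟨.box, γ⟩ (R ⊓ S) ↔
      ∀ u, ∀ v ∈ {w | T u w}, ∃ v' ∈ {w | R u w} ∩ {w | S u w}, polLE γ v' v := by
  refine forall₃_congr fun u v _ => gen_box_iff.trans ⟨?_, ?_⟩
  · rintro ⟨u', v', ⟨hRv, hSv⟩, hu, hv⟩
    exact ⟨v', ⟨hR _ _ _ _ ⟨hu, polLE_refl _ _⟩ hRv, hS _ _ _ _ ⟨hu, polLE_refl _ _⟩ hSv⟩, hv⟩
  · rintro ⟨v', h, hv⟩
    exact ⟨u, v', h, le_rfl, hv⟩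

theorem le_gen_dia_inf_iff (hR : IsMonotoneRel ⟨.dia, α⟩ R) (hS : IsMonotoneRel ⟨.dia, β⟩ S) :
    T ≤ gen ⟨.dia, γ⟩ (R ⊓ S) ↔
      ∀ u, ∀ v ∈ {w | T u w}, ∃ v' ∈ {w | R u w} ∩ {w | S u w}, polLE γ v v' := by
  refine forall₃_congr fun u v _ => gen_dia_iff.trans ⟨?_, ?_⟩
  · rintro ⟨u', v', ⟨hRv, hSv⟩, hu, hv⟩
    exact ⟨v', ⟨hR _ _ _ _ ⟨hu, polLE_refl _ _⟩ hRv, hS _ _ _ _ ⟨hu, polLE_refl _ _⟩ hSv⟩, hv⟩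
  · rintro ⟨v', h, hv⟩
    exact ⟨u, v', h, le_rfl, hv⟩

end Poset

variable {L : Set ModalSymbol} (F : ModalFrame.{u} L)

theorem boxPos_rel_le_gen_inf_iff (hp : boxPos ∈ L) (hn : boxNeg ∈ L) :
    F.rel ⟨_, hp⟩ ≤ gen boxPos (F.rel ⟨_, hp⟩ ⊓ F.rel ⟨_, hn⟩) ↔
      ∀ a b : F.Complex, F.op ⟨_, hp⟩ (a ⊔ b) ⊓ F.op ⟨_, hn⟩ b ≤ F.op ⟨_, hp⟩ a := by
  have lower (u) : IsLowerSet {v | F.rel ⟨_, hn⟩ u v} :=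
    fun _ _ h => F.mono ⟨_, hn⟩ _ _ _ _ ⟨le_rfl, h⟩
  refine (le_gen_box_inf_iff (F.mono ⟨_, hp⟩) (F.mono ⟨_, hn⟩)).trans
    ((forall_congr' fun u => forall_exists_le_iff (lower u)).trans ?_)
  exact ⟨fun h a b u hu => h u a b hu.1 hu.2, fun h u a b ha hb => h a b ⟨ha, hb⟩⟩

theorem boxNeg_rel_le_gen_inf_iff (hp : boxPos ∈ L) (hn : boxNeg ∈ L) :
    F.rel ⟨_, hn⟩ ≤ gen boxNeg (F.rel ⟨_, hp⟩ ⊓ F.rel ⟨_, hn⟩) ↔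
      ∀ a b : F.Complex, F.op ⟨_, hp⟩ a ⊓ F.op ⟨_, hn⟩ (a ⊓ b) ≤ F.op ⟨_, hn⟩ b := by
  have upper (u) : IsUpperSet {v | F.rel ⟨_, hp⟩ u v} :=
    fun _ _ h => F.mono ⟨_, hp⟩ _ _ _ _ ⟨le_rfl, h⟩
  refine (le_gen_box_inf_iff (F.mono ⟨_, hp⟩) (F.mono ⟨_, hn⟩)).trans
    ((forall_congr' fun u => forall_exists_ge_iff (upper u)).trans ?_)
  exact ⟨fun h a b u hu => h u a b hu.1 hu.2, fun h u a b ha hb => h a b ⟨ha, hb⟩⟩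

theorem notMem_op_diaPos {hp : diaPos ∈ L} {a : F.Complex} {u : F.World} :
    u ∉ (F.op ⟨_, hp⟩ a).1 ↔ ∀ v ∈ {w | F.rel ⟨_, hp⟩ u w}, v ∉ a.1 := by
  simp [ModalFrame.op, modalSet, diaPos]

theorem notMem_op_diaNeg {hn : diaNeg ∈ L} {a : F.Complex} {u : F.World} :
    u ∉ (F.op ⟨_, hn⟩ a).1 ↔ ∀ v ∈ {w | F.rel ⟨_, hn⟩ u w}, v ∈ a.1 := by
  simp [ModalFrame.op, modalSet, diaNeg]

theorem diaNeg_rel_le_gen_inf_iff (hn : diaNeg ∈ L) (hp : diaPos ∈ L) :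
    F.rel ⟨_, hn⟩ ≤ gen diaNeg (F.rel ⟨_, hn⟩ ⊓ F.rel ⟨_, hp⟩) ↔
      ∀ a b : F.Complex, F.op ⟨_, hn⟩ a ≤ F.op ⟨_, hn⟩ (a ⊔ b) ⊔ F.op ⟨_, hp⟩ b := by
  have lower (u) : IsLowerSet {v | F.rel ⟨_, hp⟩ u v} :=
    fun _ _ h => F.mono ⟨_, hp⟩ _ _ _ _ ⟨le_rfl, h⟩
  refine (le_gen_dia_inf_iff (F.mono ⟨_, hn⟩) (F.mono ⟨_, hp⟩)).trans
    ((forall_congr' fun u => forall_exists_le_iff (lower u)).trans ?_)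
  simp only [← notMem_op_diaPos, ← notMem_op_diaNeg]
  exact ⟨fun h a b u hu => or_iff_not_and_not.2 fun hn => h u a b hn.1 hn.2 hu,
    fun h u a b ha hb hu => (h a b hu).elim ha hb⟩

theorem diaPos_rel_le_gen_inf_iff (hn : diaNeg ∈ L) (hp : diaPos ∈ L) :
    F.rel ⟨_, hp⟩ ≤ gen diaPos (F.rel ⟨_, hn⟩ ⊓ F.rel ⟨_, hp⟩) ↔
      ∀ a b : F.Complex, F.op ⟨_, hp⟩ b ≤ F.op ⟨_, hn⟩ a ⊔ F.op ⟨_, hp⟩ (a ⊓ b) := by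
  have upper (u) : IsUpperSet {v | F.rel ⟨_, hn⟩ u v} :=
    fun _ _ h => F.mono ⟨_, hn⟩ _ _ _ _ ⟨le_rfl, h⟩
  refine (le_gen_dia_inf_iff (F.mono ⟨_, hn⟩) (F.mono ⟨_, hp⟩)).trans
    ((forall_congr' fun u => forall_exists_ge_iff (upper u)).trans ?_)
  simp only [← notMem_op_diaPos, ← notMem_op_diaNeg]
  exact ⟨fun h a b u hu => or_iff_not_and_not.2 fun hn => h u a b hn.1 hn.2 hu,
    fun h u a b ha hb hu => (h a b hu).elim ha hb⟩

theorem isDefinableBy_equation_boxPos_boxNeg :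
    IsDefinableBy (langDLat.sum (langModal {boxPos, boxNeg})) IsEquation
      (unimodalFrames.{u} {boxPos, boxNeg}) := by
  have hp : boxPos ∈ ({boxPos, boxNeg} : Set ModalSymbol) := .inl rfl
  have hn : boxNeg ∈ ({boxPos, boxNeg} : Set ModalSymbol) := .inr rfl
  refine isDefinableBy_pair
    (isEquation_leqn (n := 2)
      (infTerm (opTerm ⟨_, hp⟩ (supTerm (&0) (&1))) (opTerm ⟨_, hn⟩ (&1))) (opTerm ⟨_, hp⟩ (&0)))
    (isEquation_leqn (n := 2)
      (infTerm (opTerm ⟨_, hp⟩ (&0)) (opTerm ⟨_, hn⟩ (infTerm (&0) (&1)))) (opTerm ⟨_, hn⟩ (&1)))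
    fun F => ?_
  rw [mem_unimodalFrames_pair_iff hp hn subset_rfl, boxPos_rel_le_gen_inf_iff,
    boxNeg_rel_le_gen_inf_iff, realize_leqn, realize_leqn]
  exact and_congr forall_fin_two_fun.symm forall_fin_two_fun.symm

theorem isDefinableBy_equation_diaNeg_diaPos :
    IsDefinableBy (langDLat.sum (langModal {diaNeg, diaPos})) IsEquation
      (unimodalFrames.{u} {diaNeg, diaPos}) := by
  have hn : diaNeg ∈ ({diaNeg, diaPos} : Set ModalSymbol) := .inl rfl
  have hp : diaPos ∈ ({diaNeg, diaPos} : Set ModalSymbol) := .inr rfl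
  refine isDefinableBy_pair
    (isEquation_leqn (n := 2)
      (opTerm ⟨_, hn⟩ (&0)) (supTerm (opTerm ⟨_, hn⟩ (supTerm (&0) (&1))) (opTerm ⟨_, hp⟩ (&1))))
    (isEquation_leqn (n := 2)
      (opTerm ⟨_, hp⟩ (&1)) (supTerm (opTerm ⟨_, hn⟩ (&0)) (opTerm ⟨_, hp⟩ (infTerm (&0) (&1)))))
    fun F => ?_
  rw [mem_unimodalFrames_pair_iff hn hp subset_rfl, diaNeg_rel_le_gen_inf_iff,
    diaPos_rel_le_gen_inf_iff, realize_leqn, realize_leqn]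
  exact and_congr forall_fin_two_fun.symm forall_fin_two_fun.symm

end SameShape

/-! ### A box and a diamond of opposite polarities -/

section OppositePolarity

theorem forall_inf_le_imp_le_iff {A : Type*} [GeneralizedHeytingAlgebra A] {x y : A} :
    (∀ b, x ⊓ b ≤ y → b ≤ y) ↔ x ⇨ y ≤ y :=
  ⟨fun h => h _ inf_himp_le, fun h _ hb => (le_himp_iff'.2 hb).trans h⟩

theorem forall_le_sup_imp_le_iff {A : Type*} [GeneralizedCoheytingAlgebra A] {x y : A} :
    (∀ b, x ≤ y ⊔ b → x ≤ b) ↔ x ≤ x \ y :=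
  ⟨fun h => h _ le_sup_sdiff, fun h _ hb => h.trans (sdiff_le_iff.2 hb)⟩

section Poset

variable {W : Type u} [PartialOrder W] {R S : W → W → Prop} {α : Polarity} {u v : W}

theorem gen_box_inf_iff (hR : IsMonotoneRel ⟨.box, α⟩ R) (hS : IsMonotoneRel ⟨.dia, α.opp⟩ S) :
    gen ⟨.box, α⟩ (R ⊓ S) u v ↔ ∃ u', u ≤ u' ∧ R u' v ∧ S u' v := by
  rw [gen_box_iff]
  constructor
  · rintro ⟨u', v', ⟨hRv, hSv⟩, hu, hv⟩
    exact ⟨u', hu, hR _ _ _ _ ⟨le_rfl, hv⟩ hRv,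
      hS _ _ _ _ ⟨le_rfl, polLE_opp.2 (polLE_opp.2 hv)⟩ hSv⟩
  · rintro ⟨u', hu, h⟩
    exact ⟨u', v, h, hu, polLE_refl _ _⟩

theorem gen_dia_opp_inf_iff (hR : IsMonotoneRel ⟨.box, α⟩ R)
    (hS : IsMonotoneRel ⟨.dia, α.opp⟩ S) :
    gen ⟨.dia, α.opp⟩ (R ⊓ S) u v ↔ ∃ u', u' ≤ u ∧ R u' v ∧ S u' v := by
  rw [gen_dia_iff]
  constructor
  · rintro ⟨u', v', ⟨hRv, hSv⟩, hu, hv⟩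
    exact ⟨u', hu, hR _ _ _ _ ⟨le_rfl, polLE_opp.1 hv⟩ hRv,
      hS _ _ _ _ ⟨le_rfl, polLE_opp.2 hv⟩ hSv⟩
  · rintro ⟨u', hu, h⟩
    exact ⟨u', v, h, hu, polLE_refl _ _⟩

/-- The witness is the upset for which `polSet α a` consists of the worlds not `α`-below `v`. -/
theorem exists_mem_modalSet_iff (hR : IsMonotoneRel ⟨.box, α⟩ R)
    (hS : IsMonotoneRel ⟨.dia, α.opp⟩ S) (v : W) :
    ∃ a : Upset W, (∀ u, u ∈ modalSet ⟨.box, α⟩ R a.1 ↔ ¬ R u v) ∧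
      ∀ u, u ∈ modalSet ⟨.dia, α.opp⟩ S a.1 ↔ S u v := by
  obtain ⟨a, ha⟩ := exists_polSet_eq α v
  refine ⟨a, fun u => ?_, fun u => ?_⟩
  · rw [mem_modalSet_box, ha]
    exact ⟨fun h hv => h v hv (polLE_refl α v),
      fun h w hw hle => h (hR _ _ _ _ ⟨le_rfl, hle⟩ hw)⟩
  · simp only [mem_modalSet_dia, mem_polSet_opp, ha, Set.mem_ofPred_eq, not_not]
    exact ⟨fun ⟨w, hw, hle⟩ => hS _ _ _ _ ⟨le_rfl, polLE_opp.2 (polLE_opp.2 hle)⟩ hw,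
      fun hv => ⟨v, hv, polLE_refl α v⟩⟩

end Poset

variable {L : Set ModalSymbol} (F : ModalFrame.{u} L) {α : Polarity}

theorem box_rel_le_gen_inf_iff (hb : ⟨.box, α⟩ ∈ L) (hd : ⟨.dia, α.opp⟩ ∈ L) :
    F.rel ⟨_, hb⟩ ≤ gen ⟨.box, α⟩ (F.rel ⟨_, hb⟩ ⊓ F.rel ⟨_, hd⟩) ↔
      ∀ a : F.Complex, F.op ⟨_, hd⟩ a ⇨ F.op ⟨_, hb⟩ a ≤ F.op ⟨_, hb⟩ a := by
  constructor
  · refine fun h a u hu => mem_modalSet_box.2 fun v huv => by_contra fun hv => hv ?_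
    obtain ⟨u', hle, hb', hd'⟩ := (gen_box_inf_iff (F.mono ⟨_, hb⟩) (F.mono ⟨_, hd⟩)).1 (h u v huv)
    have hdia : u' ∈ (F.op ⟨_, hd⟩ a).1 := mem_modalSet_dia.2 ⟨v, hd', mem_polSet_opp.2 hv⟩
    exact mem_modalSet_box.1 (hu u' hle hdia) v hb'
  · intro h u v huv
    obtain ⟨a, hbox, hdia⟩ := exists_mem_modalSet_iff (F.mono ⟨_, hb⟩) (F.mono ⟨_, hd⟩) v
    refine (gen_box_inf_iff (F.mono ⟨_, hb⟩) (F.mono ⟨_, hd⟩)).2 (by_contra fun hno => ?_)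
    exact (hbox u).1 (h a fun u' hle hu' => (hbox u').2 fun hb' =>
      hno ⟨u', hle, hb', (hdia u').1 hu'⟩) huv

theorem dia_rel_le_gen_inf_iff (hb : ⟨.box, α⟩ ∈ L) (hd : ⟨.dia, α.opp⟩ ∈ L) :
    F.rel ⟨_, hd⟩ ≤ gen ⟨.dia, α.opp⟩ (F.rel ⟨_, hb⟩ ⊓ F.rel ⟨_, hd⟩) ↔
      ∀ a : F.Complex, F.op ⟨_, hd⟩ a ≤ F.op ⟨_, hd⟩ a \ F.op ⟨_, hb⟩ a := by
  constructor
  · intro h a u hu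
    obtain ⟨v, huv, hv⟩ := mem_modalSet_dia.1 hu
    obtain ⟨u', hle, hb', hd'⟩ :=
      (gen_dia_opp_inf_iff (F.mono ⟨_, hb⟩) (F.mono ⟨_, hd⟩)).1 (h u v huv)
    exact ⟨u', hle, mem_modalSet_dia.2 ⟨v, hd', hv⟩,
      fun hbox => mem_polSet_opp.1 hv (mem_modalSet_box.1 hbox v hb')⟩
  · intro h u v huv
    obtain ⟨a, hbox, hdia⟩ := exists_mem_modalSet_iff (F.mono ⟨_, hb⟩) (F.mono ⟨_, hd⟩) v
    obtain ⟨u', hle, hu', hnot⟩ := h a ((hdia u).2 huv)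
    exact (gen_dia_opp_inf_iff (F.mono ⟨_, hb⟩) (F.mono ⟨_, hd⟩)).2
      ⟨u', hle, not_not.1 (mt (hbox u').2 hnot), (hdia u').1 hu'⟩

variable (α) in
theorem isDefinableBy_quasiequation_box_dia_opp :
    IsDefinableBy (langDLat.sum (langModal {⟨.box, α⟩, ⟨.dia, α.opp⟩})) IsQuasiequation
      (unimodalFrames.{u} {⟨.box, α⟩, ⟨.dia, α.opp⟩}) := by
  have hb : ⟨.box, α⟩ ∈ ({⟨.box, α⟩, ⟨.dia, α.opp⟩} : Set ModalSymbol) := .inl rfl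
  have hd : ⟨.dia, α.opp⟩ ∈ ({⟨.box, α⟩, ⟨.dia, α.opp⟩} : Set ModalSymbol) := .inr rfl
  refine isDefinableBy_pair
    (isQuasiequation_qleqn (n := 2)
      (infTerm (opTerm ⟨_, hd⟩ (&0)) (&1)) (opTerm ⟨_, hb⟩ (&0)) (&1) (opTerm ⟨_, hb⟩ (&0)))
    (isQuasiequation_qleqn (n := 2)
      (opTerm ⟨_, hd⟩ (&0)) (supTerm (opTerm ⟨_, hb⟩ (&0)) (&1)) (opTerm ⟨_, hd⟩ (&0)) (&1))
    fun F => ?_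
  simp only [mem_unimodalFrames_pair_iff hb hd subset_rfl, box_rel_le_gen_inf_iff,
    dia_rel_le_gen_inf_iff, ← forall_inf_le_imp_le_iff, ← forall_le_sup_imp_le_iff, realize_qleqn]
  exact and_congr forall_fin_two_fun.symm forall_fin_two_fun.symm

variable (α) in
theorem isDefinableBy_equation_box_dia_opp :
    IsDefinableBy (langBiHA.sum (langModal {⟨.box, α⟩, ⟨.dia, α.opp⟩})) IsEquation
      (unimodalFrames.{u} {⟨.box, α⟩, ⟨.dia, α.opp⟩}) := by
  have hb : ⟨.box, α⟩ ∈ ({⟨.box, α⟩, ⟨.dia, α.opp⟩} : Set ModalSymbol) := .inl rfl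
  have hd : ⟨.dia, α.opp⟩ ∈ ({⟨.box, α⟩, ⟨.dia, α.opp⟩} : Set ModalSymbol) := .inr rfl
  refine isDefinableBy_pair
    (isEquation_eqn (n := 1) (himpTerm (opTerm ⟨_, hd⟩ (&0)) (opTerm ⟨_, hb⟩ (&0)))
      (opTerm ⟨_, hb⟩ (&0)))
    (isEquation_eqn (n := 1) (sdiffTerm (opTerm ⟨_, hd⟩ (&0)) (opTerm ⟨_, hb⟩ (&0)))
      (opTerm ⟨_, hd⟩ (&0))) fun F => ?_
  simp only [mem_unimodalFrames_pair_iff hb hd subset_rfl, box_rel_le_gen_inf_iff,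
    dia_rel_le_gen_inf_iff, realize_eqn, realize_himpTerm, realize_sdiffTerm, realize_opTerm]
  exact and_congr
    ⟨fun h x => (h (x 0)).antisymm le_himp, fun h a => (h fun _ => a).le⟩
    ⟨fun h x => sdiff_le.antisymm (h (x 0)), fun h a => (h fun _ => a).ge⟩

end OppositePolarity

/-! ### The definable cases -/

theorem subsingleton_or_eq_pair {L : Set ModalSymbol} (hL : L.encard ≤ 2)
    (hpos : L ≠ {boxPos, diaPos}) (hneg : L ≠ {boxNeg, diaNeg}) :
    L.Subsingleton ∨ L = {boxPos, boxNeg} ∨ L = {diaNeg, diaPos} ∨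
      ∃ α, L = {⟨.box, α⟩, ⟨.dia, α.opp⟩} := by
  rcases hL.lt_or_eq with hlt | heq
  · exact .inl (Set.encard_le_one_iff_subsingleton.1 (Order.le_of_lt_add_one hlt))
  · obtain ⟨⟨_ | _, _ | _⟩, ⟨_ | _, _ | _⟩, hne, rfl⟩ := Set.encard_eq_two.1 heq <;>
    simp_all [boxPos, boxNeg, diaPos, diaNeg, Polarity.opp, Set.pair_eq_pair_iff]

theorem isDefinableBy_of_encard_le_two {L : Set ModalSymbol} (hL : L.encard ≤ 2)
    (hpos : L ≠ {boxPos, diaPos}) (hneg : L ≠ {boxNeg, diaNeg}) :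
    IsDefinableBy (langDLat.sum (langModal L)) IsQuasiequation (unimodalFrames.{u} L) ∧
    IsDefinableBy (langBiHA.sum (langModal L)) IsEquation (unimodalFrames.{u} L) := by
  have of_equation {L : Set ModalSymbol}
      (h : IsDefinableBy (langDLat.sum (langModal L)) IsEquation (unimodalFrames.{u} L)) :=
    And.intro h.quasiequation_of_equation
      (h.onSentence (modalDLatToBiHA L) fun _ hφ => hφ.onSentence _)
  rcases subsingleton_or_eq_pair hL hpos hneg with hs | rfl | rfl | ⟨α, rfl⟩
  · exact ⟨isDefinableBy_of_forall_mem (mem_unimodalFrames_of_subsingleton hs),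
      isDefinableBy_of_forall_mem (mem_unimodalFrames_of_subsingleton hs)⟩
  · exact of_equation isDefinableBy_equation_boxPos_boxNeg
  · exact of_equation isDefinableBy_equation_diaNeg_diaPos
  · exact ⟨isDefinableBy_quasiequation_box_dia_opp α, isDefinableBy_equation_box_dia_opp α⟩

/-! ### Splitting the points of a dense chain -/

section TotalOrder

variable {A B : Type*}

theorem himp_eq_of_not_le [GeneralizedHeytingAlgebra A] [Std.Total (α := A) (· ≤ ·)] {a b : A}
    (h : ¬ a ≤ b) : a ⇨ b = b := by
  refine le_antisymm ?_ le_himp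
  rcases total_of (· ≤ ·) a (a ⇨ b) with h' | h'
  · exact absurd ((le_inf h' le_rfl).trans himp_inf_le) h
  · exact (le_inf le_rfl h').trans himp_inf_le

theorem sdiff_eq_of_not_le [GeneralizedCoheytingAlgebra A] [Std.Total (α := A) (· ≤ ·)] {a b : A}
    (h : ¬ a ≤ b) : a \ b = a := by
  refine le_antisymm sdiff_le ?_
  rcases total_of (· ≤ ·) (a \ b) b with h' | h'
  · exact absurd (le_sup_sdiff.trans (sup_le le_rfl h')) h
  · exact le_sup_sdiff.trans (sup_le h' le_rfl)

theorem orderEmbedding_map_inf [SemilatticeInf A] [SemilatticeInf B]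
    [Std.Total (α := A) (· ≤ ·)] (e : A ↪o B) (a b : A) : e (a ⊓ b) = e a ⊓ e b := by
  rcases total_of (· ≤ ·) a b with h | h
  · rw [inf_eq_left.2 h, inf_eq_left.2 (e.monotone h)]
  · rw [inf_eq_right.2 h, inf_eq_right.2 (e.monotone h)]

theorem orderEmbedding_map_sup [SemilatticeSup A] [SemilatticeSup B]
    [Std.Total (α := A) (· ≤ ·)] (e : A ↪o B) (a b : A) : e (a ⊔ b) = e a ⊔ e b := by
  rcases total_of (· ≤ ·) a b with h | h
  · rw [sup_eq_right.2 h, sup_eq_right.2 (e.monotone h)]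
  · rw [sup_eq_left.2 h, sup_eq_left.2 (e.monotone h)]

theorem orderEmbedding_map_himp [GeneralizedHeytingAlgebra A] [GeneralizedHeytingAlgebra B]
    [Std.Total (α := A) (· ≤ ·)] [Std.Total (α := B) (· ≤ ·)] (e : A ↪o B) (htop : e ⊤ = ⊤)
    (a b : A) : e (a ⇨ b) = e a ⇨ e b := by
  by_cases h : a ≤ b
  · rw [himp_eq_top_iff.2 h, himp_eq_top_iff.2 (e.monotone h), htop]
  · rw [himp_eq_of_not_le h, himp_eq_of_not_le (mt e.le_iff_le.1 h)]

theorem orderEmbedding_map_sdiff [GeneralizedCoheytingAlgebra A] [GeneralizedCoheytingAlgebra B]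
    [Std.Total (α := A) (· ≤ ·)] [Std.Total (α := B) (· ≤ ·)] (e : A ↪o B) (hbot : e ⊥ = ⊥)
    (a b : A) : e (a \ b) = e a \ e b := by
  by_cases h : a ≤ b
  · rw [sdiff_eq_bot_iff.2 h, sdiff_eq_bot_iff.2 (e.monotone h), hbot]
  · rw [sdiff_eq_of_not_le h, sdiff_eq_of_not_le (mt e.le_iff_le.1 h)]

end TotalOrder

instance Upset.instTotal (W : Type u) [LinearOrder W] : Std.Total (α := Upset W) (· ≤ ·) :=
  ⟨fun a b => a.2.total b.2⟩

/-- The chain obtained from `K` by replacing each point `x` by three points `x⁻ < x < x⁺`. -/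
abbrev Split (K : Type u) : Type u := K ×ₗ SignType

/-- The extension of a set of points of the chain to the new points, encoded by the sign `i` of
the new point `xⁱ`: the value at `x⁻` is the left limit, the value at `x⁺` the right limit. -/
def splitMem {K : Type u} [LT K] (A : Set K) (x : K) : SignType → Prop
  | .neg => ∃ y < x, y ∈ A
  | .zero => x ∈ A
  | .pos => ∀ y > x, y ∈ A

section Split

variable {K : Type u} [LinearOrder K] {A B : Set K} {x y : K} {i j : SignType}

theorem Split.le_iff : (toLex (x, i) : Split K) ≤ toLex (y, j) ↔ x < y ∨ x = y ∧ i ≤ j :=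
  Prod.Lex.toLex_le_toLex

theorem exists_ge_sign_ne_zero (p : Split K) : ∃ q ≥ p, (ofLex q).2 ≠ 0 :=
  ⟨toLex ((ofLex p).1, 1), Split.le_iff.2 (.inr ⟨rfl, SignType.le_one _⟩), one_ne_zero⟩

theorem exists_le_sign_ne_zero (p : Split K) : ∃ q ≤ p, (ofLex q).2 ≠ 0 :=
  ⟨toLex ((ofLex p).1, -1), Split.le_iff.2 (.inr ⟨rfl, SignType.neg_one_le _⟩),
    show (-1 : SignType) ≠ 0 by decide⟩

theorem splitMem_subset (h : A ⊆ B) (hx : splitMem A x i) : splitMem B x i := by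
  cases i with
  | zero => exact h hx
  | neg => exact hx.imp fun _ hy => ⟨hy.1, h hy.2⟩
  | pos => exact fun y hy => h (hx y hy)

section Unbounded

variable [NoMinOrder K] [NoMaxOrder K]

theorem splitMem_const {P : Prop} : splitMem {_y : K | P} x i ↔ P := by
  cases i with
  | zero => exact Iff.rfl
  | neg => exact ⟨fun ⟨_, _, h⟩ => h, fun h => (exists_lt x).imp fun _ hy => ⟨hy, h⟩⟩
  | pos => exact ⟨fun h => (exists_gt x).elim fun y hy => h y hy, fun h _ _ => h⟩

theorem forall_mem_polSet_splitMem_iff {α : Polarity} :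
    (∀ p : Split K, p ∈ polSet α {q | splitMem A (ofLex q).1 (ofLex q).2}) ↔
      ∀ x, x ∈ polSet α A := by
  refine ⟨fun h x => ?_, fun h p => ?_⟩
  · cases α <;> exact h (toLex (x, .zero))
  · cases α
    · exact splitMem_subset (fun x _ => h x) (splitMem_const.2 trivial)
    · exact fun hp => splitMem_const.1 (splitMem_subset (B := {_x | False}) (fun x => h x) hp)

theorem exists_mem_polSet_splitMem_iff {α : Polarity} :
    (∃ p : Split K, p ∈ polSet α {q | splitMem A (ofLex q).1 (ofLex q).2}) ↔
      ∃ x, x ∈ polSet α A := by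
  simpa only [mem_polSet_opp, ← not_exists, not_iff_not] using
    forall_mem_polSet_splitMem_iff (A := A) (α := α.opp)

/-- A box or a diamond along the total relation yields the top or the bottom element. -/
theorem splitMem_modalSet_top_iff (m : ModalSymbol) :
    splitMem (modalSet m ⊤ A) x i ↔
      toLex (x, i) ∈ modalSet m ⊤ {p : Split K | splitMem A (ofLex p).1 (ofLex p).2} := by
  obtain ⟨_ | _, α⟩ := m
  · have box_top {W : Type u} (a : Set W) :
        modalSet ⟨.box, α⟩ ⊤ a = {_u | ∀ v, v ∈ polSet α a} :=
      Set.ext fun _ => mem_modalSet_box.trans (forall_congr' fun _ => forall_prop_of_true trivial)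
    rw [box_top, box_top, splitMem_const]
    exact forall_mem_polSet_splitMem_iff.symm
  · have dia_top {W : Type u} (a : Set W) :
        modalSet ⟨.dia, α⟩ ⊤ a = {_u | ∃ v, v ∈ polSet α a} :=
      Set.ext fun _ => mem_modalSet_dia.trans (exists_congr fun _ => and_iff_right trivial)
    rw [dia_top, dia_top, splitMem_const]
    exact exists_mem_polSet_splitMem_iff.symm

end Unbounded

variable [DenselyOrdered K]

theorem splitMem_mono (hA : IsUpperSet A) (hle : (toLex (x, i) : Split K) ≤ toLex (y, j))
    (hx : splitMem A x i) : splitMem A y j := by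
  have to_pos {x : K} {i} (hx : splitMem A x i) : splitMem A x .pos := by
    intro z hz
    cases i with
    | zero => exact hA hz.le hx
    | neg => exact hx.elim fun w hw => hA (hw.1.trans hz).le hw.2
    | pos => exact hx z hz
  have of_neg {x : K} {i} (hx : splitMem A x .neg) : splitMem A x i := by
    obtain ⟨w, hw, hwA⟩ := hx
    cases i with
    | zero => exact hA hw.le hwA
    | neg => exact ⟨w, hw, hwA⟩
    | pos => exact fun z hz => hA (hw.trans hz).le hwA
  rcases Split.le_iff.1 hle with hxy | ⟨rfl, hij⟩
  · obtain ⟨z, hxz, hzy⟩ := exists_between hxy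
    exact of_neg ⟨z, hzy, to_pos hx z hxz⟩
  · have eq_or {i j : SignType} : i ≤ j → i = j ∨ i = .neg ∨ j = .pos := by decide +revert
    rcases eq_or hij with rfl | rfl | rfl
    exacts [hx, of_neg hx, to_pos hx]

variable (K) in
/-- The extension of upsets of a dense chain to upsets of the split chain. -/
def splitUpset : Upset K ↪o Upset (Split K) :=
  OrderEmbedding.ofMapLEIff
    (fun A => ⟨{p | splitMem A.1 (ofLex p).1 (ofLex p).2}, fun _ _ h hp => splitMem_mono A.2 h hp⟩)
    fun _ _ => ⟨fun h x hx => h (a := toLex (x, .zero)) hx, fun h _ hp => splitMem_subset h hp⟩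

theorem splitUpset_top [NoMinOrder K] [NoMaxOrder K] : splitUpset K ⊤ = ⊤ :=
  top_unique fun _ _ => splitMem_const.2 trivial

theorem splitUpset_bot [NoMinOrder K] [NoMaxOrder K] : splitUpset K ⊥ = ⊥ :=
  bot_unique fun _ hp => splitMem_const.1 hp

/-- The least new point above `p` is `x⁻` for `p = x⁻`, and `x⁺` for `p = x` and `p = x⁺`. -/
theorem forall_ge_splitMem_iff (hA : IsUpperSet A) :
    (∀ p ≥ (toLex (x, i) : Split K), (ofLex p).2 ≠ 0 → splitMem A (ofLex p).1 (ofLex p).2) ↔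
      splitMem {z | ∀ y > z, y ∈ A} x i := by
  have iff_of_isLeast {j : SignType} (hj : IsLeast {k | i ≤ k ∧ k ≠ 0} j) :
      (∀ p ≥ (toLex (x, i) : Split K), (ofLex p).2 ≠ 0 → splitMem A (ofLex p).1 (ofLex p).2) ↔
        splitMem A x j := by
    refine ⟨fun h => h (toLex (x, j)) (Split.le_iff.2 (.inr ⟨rfl, hj.1.1⟩)) hj.1.2, ?_⟩
    rintro h ⟨y, k⟩ hp hk
    exact splitMem_mono hA
      (Split.le_iff.2 ((Split.le_iff.1 hp).imp_right fun h => ⟨h.1, hj.2 ⟨h.2, hk⟩⟩)) h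
  cases i with
  | zero => exact iff_of_isLeast (j := .pos) ⟨by decide, fun k => by decide +revert⟩
  | neg =>
    refine (iff_of_isLeast (j := .neg) ⟨by decide, fun k => by decide +revert⟩).trans ⟨?_, ?_⟩
    · exact fun ⟨y, hy, hA'⟩ => ⟨y, hy, fun z hz => hA hz.le hA'⟩
    · rintro ⟨y, hy, h⟩
      obtain ⟨z, hyz, hzx⟩ := exists_between hy
      exact ⟨z, hzx, h z hyz⟩
  | pos =>
    refine (iff_of_isLeast (j := .pos) ⟨by decide, fun k => by decide +revert⟩).trans ⟨?_, ?_⟩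
    · exact fun h y hy z hz => h z (hy.trans hz)
    · intro h z hz
      obtain ⟨y, hxy, hyz⟩ := exists_between hz
      exact h y hxy z hyz

/-- The greatest new point below `p` is `x⁺` for `p = x⁺`, and `x⁻` for `p = x` and `p = x⁻`. -/
theorem exists_le_splitMem_iff (hA : IsUpperSet A) :
    (∃ p ≤ (toLex (x, i) : Split K), (ofLex p).2 ≠ 0 ∧ splitMem A (ofLex p).1 (ofLex p).2) ↔
      splitMem {z | ∃ y < z, y ∈ A} x i := by
  have iff_of_isGreatest {j : SignType} (hj : IsGreatest {k | k ≤ i ∧ k ≠ 0} j) :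
      (∃ p ≤ (toLex (x, i) : Split K), (ofLex p).2 ≠ 0 ∧ splitMem A (ofLex p).1 (ofLex p).2) ↔
        splitMem A x j := by
    refine ⟨?_, fun h => ⟨toLex (x, j), Split.le_iff.2 (.inr ⟨rfl, hj.1.1⟩), hj.1.2, h⟩⟩
    rintro ⟨⟨y, k⟩, hp, hk, h⟩
    exact splitMem_mono hA
      (Split.le_iff.2 ((Split.le_iff.1 hp).imp_right fun h => ⟨h.1, hj.2 ⟨h.2, hk⟩⟩)) h
  cases i with
  | zero => exact iff_of_isGreatest (j := .neg) ⟨by decide, fun k => by decide +revert⟩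
  | neg =>
    refine (iff_of_isGreatest (j := .neg) ⟨by decide, fun k => by decide +revert⟩).trans ⟨?_, ?_⟩
    · rintro ⟨y, hy, hyA⟩
      obtain ⟨z, hyz, hzx⟩ := exists_between hy
      exact ⟨z, hzx, y, hyz, hyA⟩
    · exact fun ⟨y, hy, z, hz, hzA⟩ => ⟨z, hz.trans hy, hzA⟩
  | pos =>
    refine (iff_of_isGreatest (j := .pos) ⟨by decide, fun k => by decide +revert⟩).trans ⟨?_, ?_⟩
    · intro h y hy
      obtain ⟨z, hxz, hzy⟩ := exists_between hy
      exact ⟨z, hzy, h z hxz⟩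
    · exact fun h y hy => (h y hy).elim fun z hz => hA hz.1.le hz.2

end Split

/-! ### Two symbols of the same polarity -/

section Reflect

/-- The identity or the negation, according to the polarity: the reflection that turns `polLE α`
into the order. -/
def reflect {W : Type u} [InvolutiveNeg W] : Polarity → W → W
  | .pos, x => x
  | .neg, x => -x

theorem reflect_reflect {W : Type u} [InvolutiveNeg W] (α : Polarity) (x : W) :
    reflect α (reflect α x) = x := by
  cases α
  exacts [rfl, neg_neg x]

variable {K : Type u} [AddCommGroup K] [LinearOrder K] [IsOrderedAddMonoid K]

theorem reflect_le_reflect_iff {α : Polarity} {x y : K} :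
    reflect α x ≤ reflect α y ↔ polLE α x y := by
  cases α
  exacts [Iff.rfl, neg_le_neg_iff]

theorem Split.reflect_le_reflect_iff {α : Polarity} {p q : Split K} :
    reflect α p ≤ reflect α q ↔ polLE α p q := by
  cases α
  · rfl
  · have sign_neg_le_neg_iff {i j : SignType} : -i ≤ -j ↔ j ≤ i := by decide +revert
    refine Split.le_iff.trans (Iff.trans ?_ Split.le_iff.symm)
    rw [neg_lt_neg_iff, neg_inj, eq_comm, sign_neg_le_neg_iff]

/-- The upset that, read through the reflection, is `polSet α A`. -/
def reflectUpset (α : Polarity) (A : Upset K) : Upset K :=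
  ⟨{x | reflect α x ∈ polSet α A.1}, fun x y hxy => polLE_mem_polSet A
    (reflect_le_reflect_iff.1 (by rwa [reflect_reflect, reflect_reflect]))⟩

theorem reflect_mem_polSet_splitUpset_iff [DenselyOrdered K] {α : Polarity} {A : Upset K}
    {p : Split K} :
    reflect α p ∈ polSet α (splitUpset K A).1 ↔
      splitMem (reflectUpset α A).1 (ofLex p).1 (ofLex p).2 := by
  rcases p with ⟨x, i⟩
  cases α
  · rfl
  cases i with
  | zero => exact Iff.rfl
  | neg =>
    change ¬ (∀ y > -x, y ∈ A.1) ↔ ∃ y < x, -y ∉ A.1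
    push Not
    rw [(Equiv.neg K).exists_congr_left]
    simp only [Equiv.neg_symm, Equiv.neg_apply, gt_iff_lt, neg_lt_neg_iff]
  | pos =>
    change ¬ (∃ y < -x, y ∈ A.1) ↔ ∀ y > x, -y ∉ A.1
    push Not
    rw [(Equiv.neg K).forall_congr_left]
    simp only [Equiv.neg_symm, Equiv.neg_apply, gt_iff_lt, neg_lt_neg_iff]

end Reflect

section Operators

variable {W : Type u} [PartialOrder W] {R : W → W → Prop} {α : Polarity} {u : W}

theorem mem_modalSet_gen_box (a : Upset W) :
    u ∈ modalSet ⟨.box, α⟩ (gen ⟨.box, α⟩ R) a.1 ↔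
      ∀ u' ≥ u, ∀ v, R u' v → v ∈ polSet α a.1 := by
  simp only [mem_modalSet_box, gen_box_iff]
  exact ⟨fun h u' hu v hR => h v ⟨u', v, hR, hu, polLE_refl α v⟩,
    fun h v ⟨u', v', hR, hu, hv⟩ => polLE_mem_polSet a hv (h u' hu v' hR)⟩

theorem mem_modalSet_gen_dia (a : Upset W) :
    u ∈ modalSet ⟨.dia, α⟩ (gen ⟨.dia, α⟩ R) a.1 ↔
      ∃ u' ≤ u, ∃ v, R u' v ∧ v ∈ polSet α a.1 := by
  simp only [mem_modalSet_dia, gen_dia_iff]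
  exact ⟨fun ⟨v, ⟨u', v', hR, hu, hv⟩, hva⟩ => ⟨u', hu, v', hR, polLE_mem_polSet a hv hva⟩,
    fun ⟨u', hu, v, hR, hv⟩ => ⟨v, ⟨u', v, hR, hu, polLE_refl α v⟩, hv⟩⟩

end Operators

section Frames

variable {K : Type u} [AddCommGroup K] [LinearOrder K]

/-- The relations on the chain: strict comparison for the symbols of polarity `α`, the total
relation for the others. The second argument is reflected if `α = -`. -/
def lineRel (α : Polarity) (m : ModalSymbol) (x y : K) : Prop :=
  m.pol = α → match m.shape with
    | .box => x < reflect α y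
    | .dia => reflect α y < x

/-- The generating relation on the split chain: each new point is related to its reflection. -/
def splitRel (α : Polarity) (p q : Split K) : Prop := (ofLex p).2 ≠ 0 ∧ q = reflect α p

/-- The unimodal frame generated by `splitRel`. -/
def splitFrame (K : Type u) [AddCommGroup K] [LinearOrder K] (α : Polarity)
    (L : Set ModalSymbol) : ModalFrame.{u} L where
  World := Split K
  rel m := gen m.1 (splitRel α)
  mono m := (gen_isLeast m.1 (splitRel α)).1.1

theorem splitFrame_mem (α : Polarity) (L : Set ModalSymbol) :
    splitFrame K α L ∈ unimodalFrames L := ⟨splitRel α, fun _ => rfl⟩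

variable [IsOrderedAddMonoid K] {α : Polarity}

theorem isMonotoneRel_lineRel (α : Polarity) (m : ModalSymbol) :
    IsMonotoneRel m (lineRel α m : K → K → Prop) := by
  obtain ⟨_ | _, β⟩ := m <;> rintro u v u' v' ⟨hu, hv⟩ hR rfl
  · exact (lt_of_le_of_lt hu (hR rfl)).trans_le (reflect_le_reflect_iff.2 hv)
  · exact (lt_of_le_of_lt (reflect_le_reflect_iff.2 (polLE_opp.1 hv)) (hR rfl)).trans_le hu

/-- The modal frame on the chain with the relations `lineRel`. -/
def lineFrame (K : Type u) [AddCommGroup K] [LinearOrder K] [IsOrderedAddMonoid K] (α : Polarity)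
    (L : Set ModalSymbol) : ModalFrame.{u} L where
  World := K
  rel m := lineRel α m.1
  mono m := isMonotoneRel_lineRel α m.1

theorem lineFrame_notMem [NoMaxOrder K] {L : Set ModalSymbol} (hb : ⟨.box, α⟩ ∈ L)
    (hd : ⟨.dia, α⟩ ∈ L) : lineFrame K α L ∉ unimodalFrames L := by
  intro h
  obtain ⟨x, hx⟩ := exists_gt (0 : K)
  have hrel : lineRel α ⟨.box, α⟩ (0 : K) (reflect α x) :=
    fun _ => (reflect_reflect α x).symm ▸ hx
  obtain ⟨u, v, hR, -⟩ := gen_box_iff.1 (mem_unimodalFrames_iff.1 h ⟨_, hb⟩ _ _ hrel)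
  simp only [iInf_apply, iInf_Prop_eq] at hR
  exact lt_asymm (α := K) (hR ⟨_, hb⟩ rfl) (hR ⟨_, hd⟩ rfl)

theorem gen_splitRel_opp (s : Shape) (p q : Split K) : gen ⟨s, α.opp⟩ (splitRel α) p q := by
  cases s
  · obtain ⟨r, hr, hr0⟩ := exists_ge_sign_ne_zero (max p (reflect α q))
    refine gen_box_iff.2 ⟨r, _, ⟨hr0, rfl⟩, (le_max_left _ _).trans hr, polLE_opp.2 ?_⟩
    rw [← Split.reflect_le_reflect_iff, reflect_reflect]
    exact (le_max_right _ _).trans hr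
  · obtain ⟨r, hr, hr0⟩ := exists_le_sign_ne_zero (min p (reflect α q))
    refine gen_dia_iff.2 ⟨r, _, ⟨hr0, rfl⟩, hr.trans (min_le_left _ _), polLE_opp.2 ?_⟩
    rw [← Split.reflect_le_reflect_iff, reflect_reflect]
    exact hr.trans (min_le_right _ _)

variable (A : Upset K)

theorem modalSet_lineRel_box : modalSet ⟨.box, α⟩ (lineRel α ⟨.box, α⟩) A.1 =
    {x | ∀ y > x, y ∈ (reflectUpset α A).1} := by
  ext x
  rw [mem_modalSet_box]
  refine ⟨fun h y hy => h _ fun _ => ?_, fun h y hy => ?_⟩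
  · rwa [reflect_reflect]
  · have := h _ (hy rfl)
    rwa [reflectUpset, Set.mem_ofPred_eq, reflect_reflect] at this

theorem modalSet_lineRel_dia : modalSet ⟨.dia, α⟩ (lineRel α ⟨.dia, α⟩) A.1 =
    {x | ∃ y < x, y ∈ (reflectUpset α A).1} := by
  ext x
  rw [mem_modalSet_dia]
  refine ⟨fun ⟨y, hy, hyA⟩ => ⟨_, hy rfl, ?_⟩, fun ⟨y, hy, hyA⟩ => ⟨_, fun _ => ?_, hyA⟩⟩
  · rwa [reflectUpset, Set.mem_ofPred_eq, reflect_reflect]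
  · rwa [reflect_reflect]

variable [DenselyOrdered K] [Nontrivial K]

theorem splitMem_modalSet_lineRel_iff (m : ModalSymbol) (x : K) (i : SignType) :
    splitMem (modalSet m (lineRel α m) A.1) x i ↔
      toLex (x, i) ∈ modalSet m (gen m (splitRel α)) (splitUpset K A).1 := by
  obtain ⟨s, β⟩ := m
  by_cases hβ : β = α
  · subst hβ
    have forall_splitRel {p : Split K} {P : Split K → Prop} :
        (∀ q, splitRel β p q → P q) ↔ ((ofLex p).2 ≠ 0 → P (reflect β p)) :=
      ⟨fun h hp => h _ ⟨hp, rfl⟩, fun h _ hq => hq.2 ▸ h hq.1⟩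
    have exists_splitRel {p : Split K} {P : Split K → Prop} :
        (∃ q, splitRel β p q ∧ P q) ↔ (ofLex p).2 ≠ 0 ∧ P (reflect β p) :=
      ⟨fun ⟨_, hq, h⟩ => ⟨hq.1, hq.2 ▸ h⟩, fun h => ⟨_, ⟨h.1, rfl⟩, h.2⟩⟩
    cases s
    · rw [modalSet_lineRel_box, mem_modalSet_gen_box]
      simp only [forall_splitRel, reflect_mem_polSet_splitUpset_iff]
      exact (forall_ge_splitMem_iff (reflectUpset β A).2).symm
    · rw [modalSet_lineRel_dia, mem_modalSet_gen_dia]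
      simp only [exists_splitRel, reflect_mem_polSet_splitUpset_iff]
      exact (exists_le_splitMem_iff (reflectUpset β A).2).symm
  · obtain rfl : β = α.opp := by cases α <;> cases β <;> first | rfl | exact absurd rfl hβ
    have lineRel_top : lineRel α ⟨s, α.opp⟩ = (⊤ : K → K → Prop) :=
      top_unique fun _ _ _ h => absurd h hβ
    have gen_top : gen ⟨s, α.opp⟩ (splitRel α) = (⊤ : Split K → Split K → Prop) :=
      top_unique fun p q _ => gen_splitRel_opp s p q
    rw [lineRel_top, gen_top]
    exact splitMem_modalSet_top_iff _

/-- The complex algebra of the frame on the chain embeds into that of the unimodal frame on the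
split chain. -/
def splitEmbedding (K : Type u) [AddCommGroup K] [LinearOrder K] [IsOrderedAddMonoid K]
    [DenselyOrdered K] [Nontrivial K] (α : Polarity) (L : Set ModalSymbol) :
    (lineFrame K α L).Complex ↪[langBiHA.sum (langModal L)] (splitFrame K α L).Complex where
  toEmbedding := (splitUpset K).toEmbedding
  map_fun' {n} f x := by
    rcases f with f | f <;> cases f
    · exact orderEmbedding_map_inf (splitUpset K) (x 0) (x 1)
    · exact orderEmbedding_map_sup (splitUpset K) (x 0) (x 1)
    · exact splitUpset_top
    · exact splitUpset_bot
    · exact orderEmbedding_map_himp (splitUpset K) splitUpset_top (x 0) (x 1)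
    · exact orderEmbedding_map_sdiff (splitUpset K) splitUpset_bot (x 0) (x 1)
    · exact Subtype.ext (Set.ext fun p =>
        splitMem_modalSet_lineRel_iff (K := K) (x 0) _ (ofLex p).1 (ofLex p).2)
  map_rel' {n} r := by rcases r with r | r <;> cases r

end Frames

theorem not_isDefinableBy_universal {L : Set ModalSymbol} {α : Polarity} (hb : ⟨.box, α⟩ ∈ L)
    (hd : ⟨.dia, α⟩ ∈ L) : ¬ IsDefinableBy (langBiHA.sum (langModal L)) IsUniversalSentence
      (unimodalFrames.{u} L) := by
  have : IsOrderedAddMonoid (ULift.{u} ℚ) :=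
    Function.Injective.isOrderedAddMonoid ULift.down (fun _ _ => rfl) Iff.rfl
  have : DenselyOrdered (ULift.{u} ℚ) :=
    ⟨fun _ _ h => (exists_between (ULift.down_lt.2 h)).elim fun c hc => ⟨⟨c⟩, hc⟩⟩
  exact not_isDefinableBy_of_embedding (lineFrame_notMem hb hd) (splitFrame_mem α L)
    (splitEmbedding (ULift.{u} ℚ) α L)

theorem encard_le_two_of_forall_not {L : Set ModalSymbol}
    (hL : ∀ α, ⟨.box, α⟩ ∈ L → ⟨.dia, α⟩ ∉ L) : L.encard ≤ 2 := by
  have pol_injOn : Set.InjOn ModalSymbol.pol L := by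
    rintro ⟨_ | _, α⟩ hx ⟨_ | _, β⟩ hy (rfl : α = β)
    exacts [rfl, absurd hy (hL α hx), absurd hx (hL α hy), rfl]
  have image_subset : ModalSymbol.pol '' L ⊆ {.pos, .neg} := by
    rintro (_ | _) _ <;> simp
  exact pol_injOn.encard_image ▸
    (Set.encard_le_encard image_subset).trans (Set.encard_pair (by simp)).le

end Unimodal

theorem mainTheorem3 (L : Set Unimodal.ModalSymbol) :
    List.TFAE [
      Unimodal.IsDefinableBy (Unimodal.langDLat.sum (Unimodal.langModal L))
        Unimodal.IsQuasiequation (Unimodal.unimodalFrames.{u} L),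
      Unimodal.IsDefinableBy (Unimodal.langDLat.sum (Unimodal.langModal L))
        Unimodal.IsUniversalSentence (Unimodal.unimodalFrames.{u} L),
      Unimodal.IsDefinableBy (Unimodal.langBiHA.sum (Unimodal.langModal L))
        Unimodal.IsEquation (Unimodal.unimodalFrames.{u} L),
      Unimodal.IsDefinableBy (Unimodal.langBiHA.sum (Unimodal.langModal L))
        Unimodal.IsUniversalSentence (Unimodal.unimodalFrames.{u} L),
      L.encard ≤ 2 ∧ L ≠ {Unimodal.boxPos, Unimodal.diaPos} ∧
        L ≠ {Unimodal.boxNeg, Unimodal.diaNeg}] := by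
  tfae_have 1 → 2 := fun h => h.mono fun _ => Unimodal.IsQuasiequation.isUniversalSentence
  tfae_have 3 → 4 := fun h => h.mono fun _ => Unimodal.IsEquation.isUniversalSentence
  tfae_have 2 → 4 := fun h => h.onSentence (Unimodal.modalDLatToBiHA L) fun _ hφ => hφ.onSentence _
  tfae_have 5 → 1 := fun ⟨h, hpos, hneg⟩ =>
    (Unimodal.isDefinableBy_of_encard_le_two h hpos hneg).1
  tfae_have 5 → 3 := fun ⟨h, hpos, hneg⟩ =>
    (Unimodal.isDefinableBy_of_encard_le_two h hpos hneg).2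
  tfae_have 4 → 5 := by
    intro h
    have hL (α : Unimodal.Polarity) (hb : ⟨.box, α⟩ ∈ L) : ⟨.dia, α⟩ ∉ L :=
      fun hd => Unimodal.not_isDefinableBy_universal hb hd h
    exact ⟨Unimodal.encard_le_two_of_forall_not hL,
      fun hpos => hL .pos (hpos ▸ .inl rfl) (hpos ▸ .inr rfl),
      fun hneg => hL .neg (hneg ▸ .inl rfl) (hneg ▸ .inr rfl)⟩
  tfae_finish
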